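/- Theorem B. Let $p\le q$ be positive integers and let $\mathrm{Gr}_{p,q}$ be the set of all $p$-dimensional linear subspaces of $\mathbb R^{p+q}$ with the standard scalar product. For $L,M\in\mathrm{Gr}_{p,q}$ choose orthonormal bases $e_1,\dots,e_p$ of $L$ and $f_1,\dots,f_p$ of $M$, let $\lambda_1\ge\dots\ge\lambda_p$ be the singular values of the matrix $(\langle e_i,f_j\rangle)_{i,j}$ (they do not depend on the choice of bases), and let $\Psi_j[L,M]=\arccos\lambda_j\in[0,\pi/2]$, $j=1,\dots,p$, be the Jordan angles between $L$ and $M$. Let $W_p$ be the group of linear transformations of $\mathbb R^p$ generated by the permutations of the coordinates and the sign changes $(t_1,\dots,t_p)\mapsto(\sigma_1t_1,\dots,\sigma_pt_p)$, $\sigma_j=\pm1$. Let $L,M,N\in\mathrm{Gr}_{p,q}$ and put $\varphi_j=\Psi_j[L,M]$, $\psi_j=\Psi_j[M,N]$, $\theta_j=\Psi_j[L,N]$. Let $\mathcal Z\subset\mathbb R^p$ be the convex hull of the $W_p$-orbit of $(\psi_1,\dots,\psi_p)$, and let $\mathcal U=(\varphi_1,\dots,\varphi_p)+\mathcal Z$.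 Then there exists a vector $(\theta_1^\circ,\dots,\theta_p^\circ)\in\mathcal U$ such that the collection $(\cos\theta_1^\circ,\dots,\cos\theta_p^\circ)$ coincides up to a permutation with the collection $(\cos\theta_1,\dots,\cos\theta_p)$. -/

import Mathlib

open Module

/-- The real Grassmannian `Gr_{p,q}`: all `p`-dimensional linear subspaces of the Euclidean
space `ℝ^{p+q}`. -/
def RealGr (p q : ℕ) : Type :=
  {L : Submodule ℝ (EuclideanSpace ℝ (Fin (p + q))) // finrank ℝ L = p}

namespace RealGr

/-- The matrix of scalar products `⟨e_i, f_j⟩` of an orthonormal basis `e` of `L` and an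
orthonormal basis `f` of `M`. -/
noncomputable def gramMatrix {p q : ℕ} {L M : RealGr p q}
    (e : OrthonormalBasis (Fin p) ℝ L.1) (f : OrthonormalBasis (Fin p) ℝ M.1) :
    Matrix (Fin p) (Fin p) ℝ :=
  Matrix.of fun i j => inner ℝ (e i : EuclideanSpace ℝ (Fin (p + q))) (f j)

/-- Some orthonormal basis of a point of the Grassmannian. -/
noncomputable def basis {p q : ℕ} (L : RealGr p q) : OrthonormalBasis (Fin p) ℝ L.1 :=
  (stdOrthonormalBasis ℝ L.1).reindex (finCongr L.2)

/-- The singular values `λ_1 ≥ … ≥ λ_p` of the matrix `⟨e_i, f_j⟩`, with `e`, `f` orthonormal bases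
of `L`, `M`. They do not depend on the bases, see `cosAngle_eq`. -/
noncomputable def cosAngle {p q : ℕ} (L M : RealGr p q) (j : Fin p) : ℝ :=
  (Matrix.toEuclideanLin (gramMatrix L.basis M.basis)).singularValues j

/-- The Jordan angles `Ψ_1[L,M] ≤ … ≤ Ψ_p[L,M]` between `L` and `M`. -/
noncomputable def jordanAngle {p q : ℕ} (L M : RealGr p q) : Fin p → ℝ :=
  fun j => Real.arccos (cosAngle L M j)

/-- The matrix `⟨e_i, f_j⟩` represents the orthogonal projection `M → L`. -/
theorem toEuclideanLin_gramMatrix {p q : ℕ} {L M : RealGr p q}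
    (e : OrthonormalBasis (Fin p) ℝ L.1) (f : OrthonormalBasis (Fin p) ℝ M.1) :
    Matrix.toEuclideanLin (gramMatrix e f) =
      e.repr.toLinearEquiv.toLinearMap ∘ₗ
        ((L.1.orthogonalProjectionOnto : _ →ₗ[ℝ] L.1) ∘ₗ M.1.subtype) ∘ₗ
        f.repr.symm.toLinearEquiv.toLinearMap := by
  refine (EuclideanSpace.basisFun (Fin p) ℝ).toBasis.ext fun j => ?_
  ext i
  simp [gramMatrix, Matrix.toLpLin_apply, e.repr_apply_apply]

/-- Singular values are unchanged under isometries of the source and the target. -/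
theorem singularValues_isometry_comp {E F E' F' : Type*}
    [NormedAddCommGroup E] [InnerProductSpace ℝ E] [FiniteDimensional ℝ E]
    [NormedAddCommGroup F] [InnerProductSpace ℝ F] [FiniteDimensional ℝ F]
    [NormedAddCommGroup E'] [InnerProductSpace ℝ E'] [FiniteDimensional ℝ E']
    [NormedAddCommGroup F'] [InnerProductSpace ℝ F'] [FiniteDimensional ℝ F']
    (T : E →ₗ[ℝ] F) (u : F ≃ₗᵢ[ℝ] F') (v : E' ≃ₗᵢ[ℝ] E) :
    (u.toLinearEquiv.toLinearMap ∘ₗ T ∘ₗ v.toLinearEquiv.toLinearMap).singularValues =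
      T.singularValues := by
  have hn : finrank ℝ E' = finrank ℝ E := v.toLinearEquiv.finrank_eq
  set S := u.toLinearEquiv.toLinearMap ∘ₗ T ∘ₗ v.toLinearEquiv.toLinearMap with hS
  have key : LinearMap.adjoint S ∘ₗ S =
      v.symm.toLinearEquiv.conj (LinearMap.adjoint T ∘ₗ T) := by
    ext x
    refine ext_inner_left ℝ fun y => ?_
    have h : inner ℝ y (v.symm (LinearMap.adjoint T (T (v x)))) =
        inner ℝ (v y) (LinearMap.adjoint T (T (v x))) := by
      rw [← v.inner_map_map, v.apply_symm_apply]
    simpa [LinearMap.adjoint_inner_right, hS, LinearEquiv.conj_apply] using h.symm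
  ext i
  by_cases hi : i < finrank ℝ E
  · rw [LinearMap.singularValues_of_lt _ hn hi, LinearMap.singularValues_of_lt _ rfl hi]
    have := (LinearMap.IsSymmetric.eigenvalues_eq_eigenvalues_iff
      S.isSymmetric_adjoint_comp_self hn T.isSymmetric_adjoint_comp_self rfl).2
      (by rw [key, LinearEquiv.charpoly_conj])
    rw [this]
  · rw [LinearMap.singularValues_of_finrank_le _ (by omega),
      LinearMap.singularValues_of_finrank_le _ (by omega)]

/-- The numbers `λ_j[L,M]` can be computed in any orthonormal bases of `L` and `M`. -/
theorem cosAngle_eq {p q : ℕ} {L M : RealGr p q}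
    (e : OrthonormalBasis (Fin p) ℝ L.1) (f : OrthonormalBasis (Fin p) ℝ M.1) (j : Fin p) :
    cosAngle L M j = (Matrix.toEuclideanLin (gramMatrix e f)).singularValues j := by
  rw [cosAngle, toEuclideanLin_gramMatrix, toEuclideanLin_gramMatrix,
    singularValues_isometry_comp, singularValues_isometry_comp]

end RealGr

/-- The permutation of coordinates `t ↦ (t_{σ 1}, …, t_{σ p})`. -/
def coordPerm {p : ℕ} (σ : Equiv.Perm (Fin p)) : (Fin p → ℝ) ≃ₗ[ℝ] (Fin p → ℝ) :=
  LinearEquiv.funCongrLeft ℝ ℝ σ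

/-- The sign change `t ↦ (ε_1 t_1, …, ε_p t_p)` with `ε_j = ±1`. -/
def coordSign {p : ℕ} (ε : Fin p → ℤˣ) : (Fin p → ℝ) ≃ₗ[ℝ] (Fin p → ℝ) :=
  LinearEquiv.piCongrRight fun j => DistribMulAction.toLinearEquiv ℝ ℝ (ε j)

theorem coordPerm_apply {p : ℕ} (σ : Equiv.Perm (Fin p)) (t : Fin p → ℝ) (j : Fin p) :
    coordPerm σ t j = t (σ j) := rfl

theorem coordSign_apply {p : ℕ} (ε : Fin p → ℤˣ) (t : Fin p → ℝ) (j : Fin p) :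
    coordSign ε t j = ((ε j : ℤ) : ℝ) * t j := by
  simp [coordSign, Units.smul_def]

/-- The Weyl group `W_p`: the group of transformations of `ℝ^p` generated by the permutations of
the coordinates and the sign changes of the coordinates. -/
def weylGroup (p : ℕ) : Subgroup ((Fin p → ℝ) ≃ₗ[ℝ] (Fin p → ℝ)) :=
  Subgroup.closure (Set.range coordPerm ∪ Set.range coordSign)

/-- The convex hull of the `W_p`-orbit of a vector of `ℝ^p`. -/
def weylHull {p : ℕ} (t : Fin p → ℝ) : Set (Fin p → ℝ) :=
  convexHull ℝ (MulAction.orbit (weylGroup p) t)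

/-!
The vector `θ - φ` itself lies in the hull `weylHull ψ`, so `θ° = θ` and no permutation is needed.
By Hahn–Banach and Abel summation, membership in the hull of the orbit of `ψ` is weak majorization
of `|θ - φ|` by `ψ`. Weak majorization follows by interpolation between `ℓ¹` and `ℓ^∞`
(`mem_weylHull_of_forall_split`): rotate `M` towards `N` along the principal planes, but stop each
rotation at a threshold `α = ψ_k`; call the result `N'`. It then suffices that

* no angle with `L` changes by more than `α` between `M` and `N'` (`abs_frameAngle_sub_le`);
* the total change between `N'` and `N` is at most `∑ (ψ_i - α)⁺` (`sum_abs_frameAngle_sub_le`).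

The first estimate is the minimax principle, together with the fact that a rotation of the frame
through angles at most `δ` changes the angle between a fixed vector and its span by at most `δ`.

For the second, let `x_i(s) ∈ L` be the projections of the rotating orthonormal basis, `y_i(s)`
those of its derivative (up to the speeds `d_i`), and `A = ∑ x_i x_iᵀ`, whose eigenvalues are the squared
cosines of the angles with `L`. For a polynomial `G`,
`d/ds tr G(A) = 2 ∑ d_i ⟨G'(A) x_i, y_i⟩`, and Bessel's inequality `∑ (x_i x_iᵀ + y_i y_iᵀ) ≤ 1`
bounds each scalar product by half of the Lipschitz constant of `u ↦ G(cos² u)`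
(`abs_inner_aeval_frameOp_le`). No differentiability of eigenvalues is needed. Every Lipschitz
function on `[0, π / 2]` is a limit of such `G(cos² u)` (`exists_polynomial_near_of_lipschitz`), and
the `ℓ¹` distance of two sorted sequences is a supremum of differences `∑ f(θ_j) - ∑ f(θ'_j)` over
`1`-Lipschitz `f` (`sum_abs_sub_le_of_forall_lipschitz`).
-/

/-! ### Differentiating the trace of a polynomial along a curve of operators -/

/-- A tracial functional differentiates a polynomial in a (noncommutative) curve as if everything
commuted. -/
theorem hasDerivAt_tracial_aeval {𝔸 : Type*} [NormedRing 𝔸] [NormedAlgebra ℝ 𝔸]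
    (τ : 𝔸 →L[ℝ] ℝ) (hτ : ∀ a b, τ (a * b) = τ (b * a)) {A : ℝ → 𝔸} {A' : 𝔸} {s : ℝ}
    (hA : HasDerivAt A A' s) (G : Polynomial ℝ) :
    HasDerivAt (fun t => τ (Polynomial.aeval (A t) G))
      (τ (Polynomial.aeval (A s) (Polynomial.derivative G) * A')) s := by
  induction G using Polynomial.induction_on' with
  | add G H hG hH => simpa [add_mul] using hG.fun_add hH
  | monomial n a =>
    have key : ∀ (n : ℕ), ∃ B : 𝔸, HasDerivAt (fun t => A t ^ n) B s ∧
        ∀ k : ℕ, τ (A s ^ k * B) = n * τ (A s ^ (k + (n - 1)) * A') := by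
      intro n
      induction n with
      | zero => exact ⟨0, by simpa using hasDerivAt_const s (1 : 𝔸), by simp⟩
      | succ n ih =>
        obtain ⟨B, hB, hk⟩ := ih
        refine ⟨B * A s + A s ^ n * A', by simpa [pow_succ] using hB.fun_mul hA, fun k => ?_⟩
        have h1 : τ (A s ^ k * (B * A s)) = τ (A s ^ (k + 1) * B) := by
          rw [← mul_assoc, hτ, ← mul_assoc, ← pow_succ']
        rw [mul_add, map_add, h1, hk, ← mul_assoc, ← pow_add]
        rcases n with _ | n
        · simp
        · have : k + 1 + n = k + (n + 1) := by omega
          simp only [this, Nat.add_sub_cancel]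
          push_cast
          ring
    obtain ⟨B, hB, hk⟩ := key n
    have h2 := τ.hasFDerivAt.comp_hasDerivAt s (hB.const_smul a)
    have h3 := hk 0
    simp only [pow_zero, one_mul, zero_add] at h3
    convert! h2 using 1
    · ext t; simp [Polynomial.aeval_monomial, Algebra.smul_def]
    · rw [Polynomial.derivative_monomial, Polynomial.aeval_monomial, ← Algebra.smul_def,
        smul_mul_assoc, map_smul, map_smul, h3, smul_eq_mul, smul_eq_mul, mul_assoc]

/-! ### Frame operators of rotating families of vectors -/

section FrameOperator

variable {ι F : Type*} [NormedAddCommGroup F] [InnerProductSpace ℝ F]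

/-- The analysis operator `z ↦ (⟨x_i, z⟩)_i` of a family of vectors `x_i`. -/
noncomputable def analysisMap (x : ι → F) : F →ₗ[ℝ] EuclideanSpace ℝ ι :=
  (WithLp.linearEquiv 2 ℝ (ι → ℝ)).symm.toLinearMap ∘ₗ
    LinearMap.pi fun i => (innerSL ℝ (x i)).toLinearMap

@[simp] theorem analysisMap_apply (x : ι → F) (z : F) (i : ι) :
    analysisMap x z i = inner ℝ (x i) z := by
  simp [analysisMap]

theorem aeval_apply_of_eigenvector {A : F →L[ℝ] F} {v : F} {μ : ℝ} (h : A v = μ • v)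
    (G : Polynomial ℝ) : Polynomial.aeval A G v = G.eval μ • v := by
  induction G using Polynomial.induction_on' with
  | add G H hG hH => simp [hG, hH, add_smul]
  | monomial n a =>
    have : (A ^ n) v = μ ^ n • v := by
      induction n with
      | zero => simp
      | succ n ih => rw [pow_succ, mul_apply_eq_comp, h, map_smul, ih, smul_smul,
          pow_succ']
    simp [Polynomial.aeval_monomial, Algebra.algebraMap_eq_smul_one, this, smul_smul]

variable [Fintype ι]

theorem norm_sq_analysisMap (x : ι → F) (z : F) :
    ‖analysisMap x z‖ ^ 2 = ∑ i, inner ℝ (x i) z ^ 2 := by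
  simp [EuclideanSpace.norm_sq_eq]

/-- The frame operator `∑ i, x_i x_iᵀ` of a family of vectors `x_i`. -/
noncomputable def frameOp (x : ι → F) : F →L[ℝ] F :=
  ∑ i, InnerProductSpace.rankOne ℝ (x i) (x i)

theorem frameOp_apply (x : ι → F) (z : F) : frameOp x z = ∑ i, inner ℝ (x i) z • x i := by
  simp [frameOp]

theorem inner_frameOp_self (x : ι → F) (z : F) :
    inner ℝ z (frameOp x z) = ∑ i, inner ℝ (x i) z ^ 2 := by
  simp only [frameOp_apply, inner_sum, inner_smul_right, sq, real_inner_comm]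

/-- The vectors `cos ψ_i β_i + sin ψ_i γ_i`. The derivative with respect to `ψ_i` is the same
expression at `ψ_i + π / 2`. -/
noncomputable def rotFrame (β γ : ι → F) (ψ : ι → ℝ) (i : ι) : F :=
  Real.cos (ψ i) • β i + Real.sin (ψ i) • γ i

theorem sum_inner_rotFrame_sq (β γ : ι → F) (ψ : ι → ℝ) (z : F) :
    ∑ i, inner ℝ (rotFrame β γ ψ i) z ^ 2 +
      ∑ i, inner ℝ (rotFrame β γ (fun i => ψ i + Real.pi / 2) i) z ^ 2 =
    ∑ i, inner ℝ (β i) z ^ 2 + ∑ i, inner ℝ (γ i) z ^ 2 := by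
  rw [← Finset.sum_add_distrib, ← Finset.sum_add_distrib]
  refine Finset.sum_congr rfl fun i _ => ?_
  simp only [rotFrame, inner_add_left, inner_smul_left, conj_trivial, Real.cos_add_pi_div_two,
    Real.sin_add_pi_div_two]
  linear_combination (inner ℝ (β i) z ^ 2 + inner ℝ (γ i) z ^ 2) * Real.sin_sq_add_cos_sq (ψ i)

theorem hasDerivAt_frameOp_rotFrame (β γ : ι → F) (a d : ι → ℝ) (s : ℝ) :
    HasDerivAt (fun t : ℝ => frameOp (rotFrame β γ fun i => a i + t * d i))
      (∑ i, d i •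
        (InnerProductSpace.rankOne ℝ (rotFrame β γ (fun i => a i + s * d i + Real.pi / 2) i)
            (rotFrame β γ (fun i => a i + s * d i) i) +
          InnerProductSpace.rankOne ℝ (rotFrame β γ (fun i => a i + s * d i) i)
            (rotFrame β γ (fun i => a i + s * d i + Real.pi / 2) i))) s := by
  unfold frameOp
  refine HasDerivAt.fun_sum fun i _ => ?_
  set R := InnerProductSpace.rankOne (E := F) (F := F) ℝ with hR
  have hu : HasDerivAt (fun t : ℝ => a i + t * d i) (d i) s := by
    simpa using ((hasDerivAt_id s).mul_const (d i)).const_add (a i)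
  have hc := hu.cos
  have hs := hu.sin
  have h := ((hc.fun_mul hc).smul_const (R (β i) (β i))).fun_add
    (((hc.fun_mul hs).smul_const (R (β i) (γ i) + R (γ i) (β i))).fun_add
      ((hs.fun_mul hs).smul_const (R (γ i) (γ i))))
  convert! h using 1
  · ext t z
    simp only [rotFrame, hR, InnerProductSpace.rankOne_apply, inner_add_left, inner_smul_left,
      conj_trivial, add_apply, smul_apply]
    module
  · ext z
    simp only [rotFrame, hR, InnerProductSpace.rankOne_apply, inner_add_left, inner_smul_left,
      conj_trivial, add_apply, smul_apply,
      Real.cos_add_pi_div_two, Real.sin_add_pi_div_two]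
    module

theorem inner_aeval_frameOp {n : ℕ} {x : ι → F} {v : OrthonormalBasis (Fin n) ℝ F} {μ : Fin n → ℝ}
    (hv : ∀ k, frameOp x (v k) = μ k • v k) (G : Polynomial ℝ) (z w : F) :
    inner ℝ (Polynomial.aeval (frameOp x) G z) w =
      ∑ k, G.eval (μ k) * (inner ℝ (v k) z * inner ℝ (v k) w) := by
  conv_lhs => rw [← v.sum_repr z]
  simp only [map_sum, map_smul, aeval_apply_of_eigenvector (hv _), sum_inner, inner_smul_left,
    v.repr_apply_apply]
  refine Finset.sum_congr rfl fun k _ => ?_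
  simp
  ring

/-- Each vector `x_i` satisfies `⟨x_i, A⁻¹ x_i⟩ ≤ 1` for `A = ∑ x_j x_jᵀ`, in the sense of the
pseudo-inverse (a zero eigenvalue contributes zero). -/
theorem sum_inner_sq_div_eigenvalue_le_one {n : ℕ} {x : ι → F}
    {v : OrthonormalBasis (Fin n) ℝ F} {μ : Fin n → ℝ}
    (hv : ∀ k, frameOp x (v k) = μ k • v k) (i : ι) :
    ∑ k, inner ℝ (v k) (x i) ^ 2 / μ k ≤ 1 := by
  set m := ∑ k, inner ℝ (v k) (x i) ^ 2 / μ k with hm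
  -- `w` is the pseudo-inverse of `A` applied to `x i`, so `⟨w, A w⟩ = ⟨x i, w⟩ = m`, while
  -- `⟨x i, w⟩ ^ 2 ≤ ⟨w, A w⟩`
  set w : F := ∑ k, (inner ℝ (v k) (x i) / μ k) • v k with hw
  have hxw : inner ℝ (x i) w = m := by
    simp only [hw, hm, inner_sum, inner_smul_right, real_inner_comm (v _) (x i)]
    exact Finset.sum_congr rfl fun k _ => by ring
  have hAw : inner ℝ w (frameOp x w) = m := by
    have h1 : frameOp x w = ∑ k, (inner ℝ (v k) (x i) / μ k * μ k) • v k := by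
      simp only [hw, map_sum, map_smul, hv, smul_smul]
    rw [h1, hw, v.orthonormal.inner_sum]
    refine Finset.sum_congr rfl fun k _ => ?_
    by_cases h : μ k = 0
    · simp [h]
    · simp only [conj_trivial]
      field_simp
  have h2 : m ^ 2 ≤ m := by
    conv_rhs => rw [← hAw, inner_frameOp_self]
    rw [← hxw]
    exact Finset.single_le_sum (f := fun j => inner ℝ (x j) w ^ 2) (fun j _ => sq_nonneg _)
      (Finset.mem_univ i)
  nlinarith

theorem inner_eigenvector_eq_zero {n : ℕ} {x : ι → F}
    {v : OrthonormalBasis (Fin n) ℝ F} {μ : Fin n → ℝ}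
    (hv : ∀ k, frameOp x (v k) = μ k • v k) {k : Fin n} (hk : μ k = 0) (i : ι) :
    inner ℝ (v k) (x i) = 0 := by
  have h : ∑ j, inner ℝ (x j) (v k) ^ 2 = 0 := by
    rw [← inner_frameOp_self, hv, hk]; simp
  have := (Finset.sum_eq_zero_iff_of_nonneg (fun j _ => sq_nonneg _)).1 h i (Finset.mem_univ i)
  rw [real_inner_comm]
  exact pow_eq_zero_iff two_ne_zero |>.1 this

variable [FiniteDimensional ℝ F]

theorem adjoint_comp_analysisMap (x : ι → F) :
    LinearMap.adjoint (analysisMap x) ∘ₗ analysisMap x = (frameOp x).toLinearMap := by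
  ext z
  refine ext_inner_left ℝ fun w => ?_
  simp [LinearMap.adjoint_inner_right, frameOp_apply, inner_sum, inner_smul_right, PiLp.inner_apply,
    real_inner_comm]

/-- The trace as a continuous linear functional on operators. -/
noncomputable def traceCLM (F : Type*) [NormedAddCommGroup F] [InnerProductSpace ℝ F]
    [FiniteDimensional ℝ F] : (F →L[ℝ] F) →L[ℝ] ℝ :=
  LinearMap.toContinuousLinearMap
    (LinearMap.trace ℝ F ∘ₗ (ContinuousLinearMap.coeLM ℝ : (F →L[ℝ] F) →ₗ[ℝ] F →ₗ[ℝ] F))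

theorem traceCLM_apply (A : F →L[ℝ] F) : traceCLM F A = LinearMap.trace ℝ F A.toLinearMap := rfl

theorem traceCLM_mul_comm (A B : F →L[ℝ] F) : traceCLM F (A * B) = traceCLM F (B * A) :=
  LinearMap.trace_mul_comm ℝ A.toLinearMap B.toLinearMap

theorem traceCLM_mul_rankOne (A : F →L[ℝ] F) (x y : F) :
    traceCLM F (A * InnerProductSpace.rankOne ℝ x y) = inner ℝ y (A x) := by
  have : A * InnerProductSpace.rankOne ℝ x y = InnerProductSpace.rankOne ℝ (A x) y := by
    ext z; simp
  rw [this, traceCLM_apply, InnerProductSpace.trace_rankOne]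

/-- Orthonormal eigenvectors of the frame operator, whose eigenvalues are the squares of the
singular values of the analysis operator. -/
theorem exists_eigenbasis_frameOp {n : ℕ} (hn : finrank ℝ F = n) (x : ι → F) :
    ∃ v : OrthonormalBasis (Fin n) ℝ F, ∀ k,
      frameOp x (v k) = (analysisMap x).singularValues k ^ 2 • v k := by
  have hT := (analysisMap x).isSymmetric_adjoint_comp_self
  refine ⟨hT.eigenvectorBasis hn, fun k => ?_⟩
  rw [LinearMap.sq_singularValues_fin _ hn, ← ContinuousLinearMap.coe_coe,
    ← adjoint_comp_analysisMap]
  exact hT.apply_eigenvectorBasis hn k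

theorem traceCLM_aeval_frameOp {n : ℕ} (hn : finrank ℝ F = n) (x : ι → F) (G : Polynomial ℝ) :
    traceCLM F (Polynomial.aeval (frameOp x) G) =
      ∑ k : Fin n, G.eval ((analysisMap x).singularValues k ^ 2) := by
  obtain ⟨v, hv⟩ := exists_eigenbasis_frameOp hn x
  rw [traceCLM_apply, LinearMap.trace_eq_sum_inner _ v]
  refine Finset.sum_congr rfl fun k _ => ?_
  simp [aeval_apply_of_eigenvector (hv k), inner_smul_right]

theorem inner_aeval_frameOp_comm (x : ι → F) (G : Polynomial ℝ) (z w : F) :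
    inner ℝ (Polynomial.aeval (frameOp x) G z) w =
      inner ℝ (Polynomial.aeval (frameOp x) G w) z := by
  obtain ⟨v, hv⟩ := exists_eigenbasis_frameOp rfl x
  simp only [inner_aeval_frameOp hv, mul_comm (inner ℝ (v _) z)]

/-- If `∑ (x_i x_iᵀ + y_i y_iᵀ) ≤ 1` and `|h(t)| · 2 √(t (1 - t)) ≤ κ` on `[0, 1]`, then
`|⟨h(A) x_i, y_i⟩| ≤ κ / 2` for `A = ∑ x_j x_jᵀ`. -/
theorem abs_inner_aeval_frameOp_le {x y : ι → F}
    (hxy : ∀ z, ∑ i, inner ℝ (x i) z ^ 2 + ∑ i, inner ℝ (y i) z ^ 2 ≤ ‖z‖ ^ 2)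
    {h : Polynomial ℝ} {κ : ℝ} (hκ : 0 ≤ κ)
    (hh : ∀ t ∈ Set.Icc (0 : ℝ) 1, 4 * (t * (1 - t)) * h.eval t ^ 2 ≤ κ ^ 2) (i : ι) :
    |inner ℝ (y i) (Polynomial.aeval (frameOp x) h (x i))| ≤ κ / 2 := by
  obtain ⟨v, hv⟩ := exists_eigenbasis_frameOp rfl x
  set μ : Fin (finrank ℝ F) → ℝ := fun k => (analysisMap x).singularValues k ^ 2 with hμ
  have hv' : ∀ k, frameOp x (v k) = μ k • v k := hv
  have hμ0 : ∀ k, 0 ≤ μ k := fun k => sq_nonneg _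
  have hμ1 : ∀ k, μ k ≤ 1 := by
    intro k
    have h1 := hxy (v k)
    rw [← inner_frameOp_self, hv', inner_smul_right, real_inner_self_eq_norm_sq] at h1
    have h2 : 0 ≤ ∑ i, inner ℝ (y i) (v k) ^ 2 := Finset.sum_nonneg fun _ _ => sq_nonneg _
    simp at h1
    linarith
  set z := Polynomial.aeval (frameOp x) h (x i) with hz
  have hvz : ∀ k, inner ℝ (v k) z = h.eval (μ k) * inner ℝ (v k) (x i) := by
    intro k
    rw [real_inner_comm, hz, inner_aeval_frameOp hv', Finset.sum_eq_single k]
    · simp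
    · intro j _ hj
      rw [v.orthonormal.inner_eq_zero hj]; simp
    · simp
  have hn : ‖z‖ ^ 2 = ∑ k, inner ℝ (v k) z ^ 2 := by
    rw [← v.sum_sq_norm_inner_right z]; simp
  have hA : ∑ i, inner ℝ (x i) z ^ 2 = ∑ k, μ k * inner ℝ (v k) z ^ 2 := by
    have := inner_aeval_frameOp hv' Polynomial.X z z
    rw [← inner_frameOp_self, real_inner_comm]
    simpa [sq] using this
  have hy : inner ℝ (y i) z ^ 2 ≤ ∑ j, inner ℝ (y j) z ^ 2 :=
    Finset.single_le_sum (f := fun j => inner ℝ (y j) z ^ 2) (fun j _ => sq_nonneg _)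
      (Finset.mem_univ i)
  have h1 : inner ℝ (y i) z ^ 2 ≤ ∑ k, (1 - μ k) * inner ℝ (v k) z ^ 2 := by
    have := hxy z
    rw [hn, hA] at this
    simp only [sub_mul, one_mul, Finset.sum_sub_distrib]
    linarith
  -- `(1 - μ) h(μ)² ≤ κ² / (4 μ)`, and the sum of `⟨v_k, x_i⟩² / μ_k` is at most one
  have h2 : ∑ k, (1 - μ k) * inner ℝ (v k) z ^ 2 ≤
      ∑ k, κ ^ 2 / 4 * (inner ℝ (v k) (x i) ^ 2 / μ k) := by
    refine Finset.sum_le_sum fun k _ => ?_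
    rw [hvz]
    rcases (hμ0 k).eq_or_lt with h0 | h0
    · rw [inner_eigenvector_eq_zero hv' h0.symm]; simp
    · rw [mul_div_assoc', le_div_iff₀ h0]
      have := mul_le_mul_of_nonneg_right (hh (μ k) ⟨hμ0 k, hμ1 k⟩)
        (sq_nonneg (inner ℝ (v k) (x i)))
      nlinarith
  rw [← Finset.mul_sum] at h2
  have h3 := mul_le_mul_of_nonneg_left (sum_inner_sq_div_eigenvalue_le_one hv' i)
    (by positivity : 0 ≤ κ ^ 2 / 4)
  refine abs_le_of_sq_le_sq ?_ (by positivity)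
  linarith [show (κ / 2) ^ 2 = κ ^ 2 / 4 by ring]

/-- Along the rotation of the frame, `∑ G(σ_k²)` varies by at most `κ` times the total rotation,
for a polynomial `G` with `|G'(t)| · 2 √(t (1 - t)) ≤ κ` on `[0, 1]`, that is, such that
`u ↦ G(cos² u)` is `κ`-Lipschitz. -/
theorem abs_sum_eval_sq_singularValues_sub_le {n : ℕ} (hn : finrank ℝ F = n) {β γ : ι → F}
    (hβγ : ∀ z, ∑ i, inner ℝ (β i) z ^ 2 + ∑ i, inner ℝ (γ i) z ^ 2 ≤ ‖z‖ ^ 2)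
    {G : Polynomial ℝ} {κ : ℝ} (hκ : 0 ≤ κ)
    (hG : ∀ t ∈ Set.Icc (0 : ℝ) 1, 4 * (t * (1 - t)) * G.derivative.eval t ^ 2 ≤ κ ^ 2)
    (ψ ψ' : ι → ℝ) :
    |∑ k : Fin n, G.eval ((analysisMap (rotFrame β γ ψ')).singularValues k ^ 2) -
      ∑ k : Fin n, G.eval ((analysisMap (rotFrame β γ ψ)).singularValues k ^ 2)| ≤
      κ * ∑ i, |ψ' i - ψ i| := by
  set d : ι → ℝ := fun i => ψ' i - ψ i with hd
  set f : ℝ → ℝ := fun t =>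
    traceCLM F (Polynomial.aeval (frameOp (rotFrame β γ fun i => ψ i + t * d i)) G) with hf
  -- interpolate linearly between `ψ` and `ψ'` and apply the mean value inequality
  have hder := fun s => hasDerivAt_tracial_aeval (traceCLM F) traceCLM_mul_comm
    (hasDerivAt_frameOp_rotFrame β γ ψ d s) G
  have hbound : ∀ s ∈ Set.Ico (0 : ℝ) 1, ‖_‖ ≤ _ := fun s _ => by
    set x := rotFrame β γ fun i => ψ i + s * d i with hx
    set y := rotFrame β γ fun i => ψ i + s * d i + Real.pi / 2 with hy
    have hxy : ∀ z, ∑ i, inner ℝ (x i) z ^ 2 + ∑ i, inner ℝ (y i) z ^ 2 ≤ ‖z‖ ^ 2 := fun z => by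
      rw [hx, hy, sum_inner_rotFrame_sq]
      exact hβγ z
    show ‖traceCLM F (Polynomial.aeval (frameOp x) (Polynomial.derivative G) *
      ∑ i, d i • (InnerProductSpace.rankOne ℝ (y i) (x i) +
        InnerProductSpace.rankOne ℝ (x i) (y i)))‖ ≤ κ * ∑ i, |d i|
    rw [Finset.mul_sum, map_sum, Finset.mul_sum]
    refine (norm_sum_le _ _).trans (Finset.sum_le_sum fun i _ => ?_)
    rw [mul_smul_comm, map_smul, mul_add, map_add, traceCLM_mul_rankOne, traceCLM_mul_rankOne,
      real_inner_comm, inner_aeval_frameOp_comm, real_inner_comm, norm_smul, Real.norm_eq_abs,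
      Real.norm_eq_abs, mul_comm]
    refine mul_le_mul_of_nonneg_right ?_ (abs_nonneg _)
    have := abs_inner_aeval_frameOp_le hxy hκ hG i
    rw [← two_mul, abs_mul, abs_two]
    linarith
  have := norm_image_sub_le_of_norm_deriv_le_segment_01'
    (fun s _ => (hder s).hasDerivWithinAt) hbound
  simpa [← traceCLM_aeval_frameOp hn, hd] using this

end FrameOperator

/-! ### The `ℓ¹` distance of sorted sequences by duality -/

/-- For two sequences sorted in the same direction, `∑ |x_j - y_j|` is the largest value of
`∑ (f(x_j) - f(y_j))` over `1`-Lipschitz functions `f`. -/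
theorem sum_abs_sub_le_of_forall_lipschitz {n : ℕ} {x y : Fin n → ℝ} (hx : Monotone x)
    (hy : Monotone y) {C : ℝ}
    (h : ∀ f : ℝ → ℝ, LipschitzWith 1 f → ∑ j, f (x j) - ∑ j, f (y j) ≤ C) :
    ∑ j, |x j - y j| ≤ C := by
  -- the optimal `f` has slope `1` on `P`, slope `-1` on `Q`, and slope `0` elsewhere
  set P : Set ℝ := ⋃ j, Set.Ioc (y j) (x j) with hP
  set Q : Set ℝ := ⋃ j, Set.Ioc (x j) (y j) with hQ
  have hPm : MeasurableSet P := MeasurableSet.iUnion fun j => measurableSet_Ioc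
  have hQm : MeasurableSet Q := MeasurableSet.iUnion fun j => measurableSet_Ioc
  -- `P` and `Q` are disjoint since both sequences are sorted
  have hPQ : Disjoint P Q := by
    rw [Set.disjoint_left]
    intro u hu hu'
    obtain ⟨j, hj1, hj2⟩ := Set.mem_iUnion.1 hu
    obtain ⟨i, hi1, hi2⟩ := Set.mem_iUnion.1 hu'
    have hij : i ≤ j := le_of_lt <| by
      by_contra! hji
      exact absurd (hx hji) (by linarith)
    exact absurd (hy hij) (by linarith)
  set s : ℝ → ℝ := fun u => P.indicator 1 u - Q.indicator 1 u with hs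
  have hs1 : ∀ u, ‖s u‖ ≤ 1 := fun u => by
    by_cases h1 : u ∈ P <;> by_cases h2 : u ∈ Q <;> simp [hs, h1, h2]
  have hsm : Measurable s :=
    (measurable_one.indicator hPm).sub (measurable_one.indicator hQm)
  have hsi : ∀ a b : ℝ, IntervalIntegrable s MeasureTheory.volume a b := fun a b =>
    (intervalIntegrable_const (c := (1 : ℝ))).mono_fun hsm.aestronglyMeasurable
      (Filter.Eventually.of_forall fun u => by simpa using hs1 u)
  set f : ℝ → ℝ := fun t => ∫ u in (0 : ℝ)..t, s u with hf
  have hfsub : ∀ a b, f b - f a = ∫ u in a..b, s u := fun a b =>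
    intervalIntegral.integral_interval_sub_left (hsi _ _) (hsi _ _)
  have hfL : LipschitzWith 1 f := by
    refine LipschitzWith.of_dist_le_mul fun b a => ?_
    rw [Real.dist_eq, Real.dist_eq, hfsub, ← Real.norm_eq_abs]
    simpa using intervalIntegral.norm_integral_le_of_norm_le_const (a := a) (b := b)
      (C := 1) (f := s) fun u _ => hs1 u
  have hfj : ∀ j, f (x j) - f (y j) = |x j - y j| := fun j => by
    rw [hfsub]
    rcases le_total (y j) (x j) with hj | hj
    · rw [abs_of_nonneg (sub_nonneg.2 hj)]
      have : ∫ u in (y j)..(x j), s u = ∫ u in (y j)..(x j), (1 : ℝ) := by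
        refine intervalIntegral.integral_congr_uIoo fun u hu => ?_
        rw [Set.uIoo_of_le hj] at hu
        have h1 : u ∈ P := Set.mem_iUnion.2 ⟨j, hu.1, hu.2.le⟩
        simp [hs, h1, Set.disjoint_left.1 hPQ h1]
      rw [this]; simp
    · rw [abs_of_nonpos (sub_nonpos.2 hj)]
      have : ∫ u in (y j)..(x j), s u = ∫ u in (y j)..(x j), (-1 : ℝ) := by
        refine intervalIntegral.integral_congr_uIoo fun u hu => ?_
        rw [Set.uIoo_of_ge hj] at hu
        have h1 : u ∈ Q := Set.mem_iUnion.2 ⟨j, hu.1, hu.2.le⟩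
        simp [hs, h1, Set.disjoint_right.1 hPQ h1]
      rw [this]; simp
  have := h f hfL
  rw [← Finset.sum_sub_distrib] at this
  simpa [hfj] using this

/-! ### Polynomial approximation of Lipschitz functions of the angle -/

theorem exists_polynomial_derivative_eq (P : Polynomial ℝ) :
    ∃ G : Polynomial ℝ, G.derivative = P := by
  induction P using Polynomial.induction_on' with
  | add P Q hP hQ =>
    obtain ⟨G, rfl⟩ := hP
    obtain ⟨H, rfl⟩ := hQ
    exact ⟨G + H, by simp⟩
  | monomial n a =>
    refine ⟨Polynomial.monomial (n + 1) (a / (n + 1)), ?_⟩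
    rw [Polynomial.derivative_monomial]
    have : (n + 1 : ℝ) ≠ 0 := by positivity
    simp [this]

/-- A `1`-Lipschitz function is uniformly close to a `C¹` function whose derivative is bounded
by `1` and vanishes near `0` and near `π / 2`. -/
theorem exists_hasDerivAt_near_of_lipschitz {f : ℝ → ℝ} (hf : LipschitzWith 1 f) {ε : ℝ}
    (hε : 0 < ε) :
    ∃ g w : ℝ → ℝ, Continuous w ∧ (∀ u, HasDerivAt g (w u) u) ∧ (∀ u, |w u| ≤ 1) ∧
      (∀ u, w u ≠ 0 → u ∈ Set.Icc ε (Real.pi / 2 - ε)) ∧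
      ∀ u ∈ Set.Icc 0 (Real.pi / 2), |g u - f u| ≤ 3 * ε := by
  have hpi := Real.pi_gt_three
  -- make `f` constant near the ends of the interval, then average it over `[u, u + ε]`
  set a := 2 * ε with ha
  set b := Real.pi / 2 - 2 * ε with hb
  set c : ℝ → ℝ := fun u => max a (min u b) with hc
  set f₁ : ℝ → ℝ := fun u => f (c u) with hf₁
  have hcL : ∀ u v, |c u - c v| ≤ |u - v| := fun u v =>
    (abs_max_sub_max_le_max _ _ _ _).trans <| by
      rw [sub_self, abs_zero, max_eq_right (abs_nonneg _)]
      refine (abs_min_sub_min_le_max _ _ _ _).trans ?_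
      rw [sub_self, abs_zero, max_eq_left (abs_nonneg _)]
  have hfL : ∀ u v, |f u - f v| ≤ |u - v| := fun u v => by
    simpa [Real.dist_eq] using hf.dist_le_mul u v
  have hf₁L : ∀ u v, |f₁ u - f₁ v| ≤ |u - v| := fun u v => (hfL _ _).trans (hcL _ _)
  have hf₁c : Continuous f₁ := by
    have := hf.continuous
    fun_prop
  have hf₁i : ∀ u v : ℝ, IntervalIntegrable f₁ MeasureTheory.volume u v := fun u v =>
    hf₁c.intervalIntegrable u v
  set w : ℝ → ℝ := fun u => ε⁻¹ * (f₁ (u + ε) - f₁ u) with hw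
  refine ⟨fun u => ε⁻¹ * ((∫ t in (0 : ℝ)..(u + ε), f₁ t) - ∫ t in (0 : ℝ)..u, f₁ t), w,
    by fun_prop, fun u => ?_, fun u => ?_, fun u => ?_, fun u hu => ?_⟩
  · have h1 : ∀ u, HasDerivAt (fun u => ∫ t in (0 : ℝ)..u, f₁ t) (f₁ u) u := fun u =>
      intervalIntegral.integral_hasDerivAt_right (hf₁i _ _)
        (hf₁c.stronglyMeasurableAtFilter _ _) hf₁c.continuousAt
    exact (((h1 (u + ε)).comp_add_const u ε).sub (h1 u)).const_mul _
  · rw [hw, abs_mul, abs_inv, abs_of_pos hε, inv_mul_le_iff₀ hε]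
    simpa [abs_of_pos hε] using hf₁L (u + ε) u
  · contrapose!
    intro hu
    have : c (u + ε) = c u := by
      simp only [hc]
      by_cases h : u < ε
      · rw [max_eq_left, max_eq_left]
        · exact (min_le_left _ _).trans (by linarith)
        · exact (min_le_left _ _).trans (by linarith)
      · have h2 : ¬ u ≤ Real.pi / 2 - ε := fun h3 => hu ⟨not_lt.1 h, h3⟩
        rw [min_eq_right, min_eq_right] <;> linarith
    simp [hw, hf₁, this]
  · have h1 : (∫ t in (0 : ℝ)..(u + ε), f₁ t) - ∫ t in (0 : ℝ)..u, f₁ t =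
        ∫ t in u..(u + ε), f₁ t :=
      intervalIntegral.integral_interval_sub_left (hf₁i _ _) (hf₁i _ _)
    have h2 : ε⁻¹ * (∫ t in u..(u + ε), f₁ t) - f₁ u =
        ε⁻¹ * ∫ t in u..(u + ε), (f₁ t - f₁ u) := by
      rw [intervalIntegral.integral_sub (hf₁i _ _) intervalIntegrable_const, mul_sub]
      simp [hε.ne']
    have h3 : ‖∫ t in u..(u + ε), (f₁ t - f₁ u)‖ ≤ ε * |u + ε - u| := by
      refine intervalIntegral.norm_integral_le_of_norm_le_const fun t ht => ?_
      rw [Set.uIoc_of_le (by linarith)] at ht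
      refine (hf₁L t u).trans ?_
      rw [abs_of_pos (by linarith [ht.1])]
      linarith [ht.2]
    have h4 : |ε⁻¹ * (∫ t in u..(u + ε), f₁ t) - f₁ u| ≤ ε := by
      rw [h2, abs_mul, abs_inv, abs_of_pos hε, inv_mul_le_iff₀ hε]
      simpa [abs_of_pos hε] using h3
    have h5 : |f₁ u - f u| ≤ 2 * ε := by
      refine (hfL _ _).trans ?_
      simp only [hc]
      rw [abs_le]
      have := hu.1
      have := hu.2
      constructor
      · rcases min_cases u b with h | h <;> linarith [le_max_right a (min u b)]
      · rcases max_cases a (min u b) with h | h <;> linarith [min_le_left u b]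
    simp only [h1]
    have := abs_sub_le (ε⁻¹ * (∫ t in u..(u + ε), f₁ t)) (f₁ u) (f u)
    linarith

theorem sin_two_mul_ge {ε u : ℝ} (hε : 0 ≤ ε) (hu : u ∈ Set.Icc ε (Real.pi / 2 - ε)) :
    Real.sin (2 * ε) ≤ Real.sin (2 * u) := by
  obtain ⟨h1, h2⟩ := hu
  have := Real.pi_pos
  rcases le_total (2 * u) (Real.pi / 2) with h | h
  · exact Real.sin_le_sin_of_le_of_le_pi_div_two (by linarith) h (by linarith)
  · rw [← Real.sin_pi_sub (2 * u)]
    exact Real.sin_le_sin_of_le_of_le_pi_div_two (by linarith) (by linarith) (by linarith)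

/-- A `1`-Lipschitz function on `[0, π / 2]` is a uniform limit of functions `G(cos² u)`, with
polynomials `G` for which these functions are almost `1`-Lipschitz. -/
theorem exists_polynomial_near_of_lipschitz {f : ℝ → ℝ} (hf : LipschitzWith 1 f) {ε : ℝ}
    (hε : 0 < ε) (hε' : ε ≤ 1 / 4) :
    ∃ G : Polynomial ℝ,
      (∀ t ∈ Set.Icc (0 : ℝ) 1, 4 * (t * (1 - t)) * G.derivative.eval t ^ 2 ≤ (1 + ε) ^ 2) ∧
      ∀ u ∈ Set.Icc 0 (Real.pi / 2), |G.eval (Real.cos u ^ 2) - f u| ≤ 5 * ε := by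
  have hpi := Real.pi_gt_three
  have hpi4 := Real.pi_lt_four
  obtain ⟨g, w, hwc, hgw, hw1, hw0, hgf⟩ := exists_hasDerivAt_near_of_lipschitz hf hε
  have hm : 0 < Real.sin (2 * ε) := Real.sin_pos_of_pos_of_lt_pi (by linarith) (by linarith)
  -- `G(cos² u)` has derivative `-G'(cos² u) sin 2u`, so `G'(cos² u)` has to approximate
  -- `-w(u) / sin 2u`; the maximum only matters where `w` vanishes
  set V : ℝ → ℝ := fun u => -w u / max (Real.sin (2 * u)) (Real.sin (2 * ε)) with hV
  have hVc : Continuous V := by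
    refine hwc.neg.div (by fun_prop) fun u => ?_
    exact (lt_max_of_lt_right hm).ne'
  have hVw : ∀ u, V u * Real.sin (2 * u) = -w u := fun u => by
    by_cases h : w u = 0
    · simp [hV, h]
    · have := sin_two_mul_ge hε.le (hw0 u h)
      simp only [hV, max_eq_left this]
      field_simp [(hm.trans_le this).ne']
  obtain ⟨P, hP⟩ := exists_polynomial_near_of_continuousOn 0 1
    (fun x => V (Real.arccos (Real.sqrt x))) (by fun_prop) ε hε
  have hP' : ∀ u ∈ Set.Icc 0 (Real.pi / 2), |P.eval (Real.cos u ^ 2) - V u| ≤ ε := fun u hu => by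
    have hc : 0 ≤ Real.cos u := Real.cos_nonneg_of_mem_Icc ⟨by linarith [hu.1], hu.2⟩
    have := hP (Real.cos u ^ 2) ⟨sq_nonneg _, Real.cos_sq_le_one u⟩
    rw [Real.sqrt_sq hc, Real.arccos_cos hu.1 (by linarith [hu.2])] at this
    exact this.le
  have hPs : ∀ u ∈ Set.Icc 0 (Real.pi / 2),
      |P.eval (Real.cos u ^ 2) * Real.sin (2 * u) + w u| ≤ ε := fun u hu => by
    have h1 : P.eval (Real.cos u ^ 2) * Real.sin (2 * u) + w u =
        (P.eval (Real.cos u ^ 2) - V u) * Real.sin (2 * u) := by rw [sub_mul, hVw]; ring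
    rw [h1, abs_mul]
    calc _ ≤ ε * 1 := mul_le_mul (hP' u hu) (Real.abs_sin_le_one _) (abs_nonneg _) hε.le
      _ = ε := mul_one _
  obtain ⟨G₀, hG₀⟩ := exists_polynomial_derivative_eq P
  refine ⟨G₀ + Polynomial.C (g 0 - G₀.eval 1), fun t ht => ?_, fun u hu => ?_⟩
  · set u := Real.arccos (Real.sqrt t) with hu
    have hu' : u ∈ Set.Icc 0 (Real.pi / 2) :=
      ⟨Real.arccos_nonneg _, Real.arccos_le_pi_div_two.2 (Real.sqrt_nonneg _)⟩
    have hcu : Real.cos u = Real.sqrt t := Real.cos_arccos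
      (by linarith [Real.sqrt_nonneg t]) (Real.sqrt_le_one.2 ht.2)
    have hct : Real.cos u ^ 2 = t := by rw [hcu, Real.sq_sqrt ht.1]
    have h1 : 4 * (t * (1 - t)) = Real.sin (2 * u) ^ 2 := by
      rw [Real.sin_two_mul, mul_pow, mul_pow, Real.sin_sq, hct]; ring
    have h2 := hPs u hu'
    rw [hct] at h2
    have h3 : |P.eval t * Real.sin (2 * u)| ≤ 1 + ε := by
      have := abs_sub (P.eval t * Real.sin (2 * u) + w u) (w u)
      rw [add_sub_cancel_right] at this
      linarith [hw1 u]
    simp only [Polynomial.derivative_add, Polynomial.derivative_C, add_zero, hG₀]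
    rw [h1, ← mul_pow, mul_comm]
    exact sq_le_sq' (abs_le.1 h3).1 (abs_le.1 h3).2
  · set k : ℝ → ℝ := fun u => G₀.eval (Real.cos u ^ 2) - g u with hk
    have hkd : ∀ u, HasDerivAt k (-(P.eval (Real.cos u ^ 2) * Real.sin (2 * u) + w u)) u := by
      intro u
      have h1 := (G₀.hasDerivAt (Real.cos u ^ 2)).comp u ((Real.hasDerivAt_cos u).fun_pow 2)
      refine (h1.sub (hgw u)).congr_deriv ?_
      rw [hG₀, Real.sin_two_mul]
      push_cast
      ring
    have h2 := (convex_Icc (0 : ℝ) (Real.pi / 2)).norm_image_sub_le_of_norm_hasDerivWithin_le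
      (fun v _ => (hkd v).hasDerivWithinAt)
      (fun v hv => by rw [norm_neg]; exact hPs v hv) ⟨le_rfl, by linarith⟩ hu
    have h3 : |k u - k 0| ≤ 2 * ε := by
      refine h2.trans ?_
      rw [sub_zero, Real.norm_eq_abs, abs_of_nonneg hu.1]
      nlinarith [hu.2]
    have h4 := hgf u hu
    have h5 : (G₀ + Polynomial.C (g 0 - G₀.eval 1)).eval (Real.cos u ^ 2) - f u =
        (k u - k 0) + (g u - f u) := by
      simp [hk]
      ring
    rw [h5]
    linarith [abs_add_le (k u - k 0) (g u - f u)]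

/-! ### The `ℓ¹` and `ℓ^∞` estimates for the angles -/

section Angles

variable {ι F : Type*} [Fintype ι] [NormedAddCommGroup F] [InnerProductSpace ℝ F]

theorem sum_inner_rotFrame_sq_le {β γ : ι → F}
    (hβγ : ∀ z, ∑ i, inner ℝ (β i) z ^ 2 + ∑ i, inner ℝ (γ i) z ^ 2 ≤ ‖z‖ ^ 2) (ψ : ι → ℝ) (z : F) :
    ∑ i, inner ℝ (rotFrame β γ ψ i) z ^ 2 ≤ ‖z‖ ^ 2 := by
  have h1 := sum_inner_rotFrame_sq β γ ψ z
  have h2 : 0 ≤ ∑ i, inner ℝ (rotFrame β γ (fun i => ψ i + Real.pi / 2) i) z ^ 2 :=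
    Finset.sum_nonneg fun _ _ => sq_nonneg _
  linarith [hβγ z]

/-- Rotating the frame by angles at most `δ` increases the angle `arccos ‖T z‖` of a unit vector
`z` by at most `δ`. -/
theorem arccos_norm_analysisMap_le {β γ : ι → F}
    (hβγ : ∀ z, ∑ i, inner ℝ (β i) z ^ 2 + ∑ i, inner ℝ (γ i) z ^ 2 ≤ ‖z‖ ^ 2) {ψ ψ' : ι → ℝ}
    {δ : ℝ} (hδ : δ ∈ Set.Icc 0 (Real.pi / 2)) (hψ : ∀ i, |ψ' i - ψ i| ≤ δ) {z : F}
    (hz : ‖z‖ = 1) :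
    Real.arccos ‖analysisMap (rotFrame β γ ψ') z‖ ≤
      Real.arccos ‖analysisMap (rotFrame β γ ψ) z‖ + δ := by
  obtain ⟨hδ0, hδ1⟩ := hδ
  have hpi := Real.pi_pos
  set b : EuclideanSpace ℝ ι := analysisMap (rotFrame β γ ψ) z with hb
  set c : EuclideanSpace ℝ ι :=
    analysisMap (rotFrame β γ fun i => ψ i + Real.pi / 2) z with hc
  set b' : EuclideanSpace ℝ ι := analysisMap (rotFrame β γ ψ') z with hb'
  have hbc : ‖b‖ ^ 2 + ‖c‖ ^ 2 ≤ 1 := by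
    rw [hb, hc, norm_sq_analysisMap, norm_sq_analysisMap, sum_inner_rotFrame_sq]
    simpa [hz] using hβγ z
  have hb1 : ‖b‖ ≤ 1 := by nlinarith [norm_nonneg b, sq_nonneg ‖c‖]
  set α := Real.arccos ‖b‖ with hα
  have hcos : Real.cos α = ‖b‖ := Real.cos_arccos (by linarith [norm_nonneg b]) hb1
  have hα1 : α ≤ Real.pi / 2 := Real.arccos_le_pi_div_two.2 (norm_nonneg _)
  have hα0 : 0 ≤ α := Real.arccos_nonneg _
  have hsin : 0 ≤ Real.sin α := Real.sin_nonneg_of_nonneg_of_le_pi hα0 (by linarith)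
  have hcs : ‖c‖ ≤ Real.sin α := by
    refine le_of_sq_le_sq ?_ hsin
    have := Real.sin_sq_add_cos_sq α
    rw [hcos] at this
    linarith
  have hsd : 0 ≤ Real.sin δ := Real.sin_nonneg_of_nonneg_of_le_pi hδ0 (by linarith)
  -- the lower bound for `‖b'‖` comes from its scalar product with `b`
  suffices h : Real.cos (α + δ) ≤ ‖b'‖ by
    rw [← Real.arccos_cos (by linarith : 0 ≤ α + δ) (by linarith)]
    exact Real.arccos_le_arccos h
  rcases (norm_nonneg b).eq_or_lt with h0 | h0
  · rw [Real.cos_add, hcos, ← h0]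
    nlinarith [norm_nonneg b', mul_nonneg hsin hsd]
  have hcoord : ∀ i, b' i = Real.cos (ψ' i - ψ i) * b i + Real.sin (ψ' i - ψ i) * c i := fun i => by
    have h1 : Real.cos (ψ' i) = Real.cos (ψ' i - ψ i + ψ i) := by ring_nf
    have h2 : Real.sin (ψ' i) = Real.sin (ψ' i - ψ i + ψ i) := by ring_nf
    simp only [hb, hb', hc, analysisMap_apply, rotFrame, inner_add_left, inner_smul_left,
      conj_trivial, Real.cos_add_pi_div_two, Real.sin_add_pi_div_two]
    rw [h1, h2, Real.cos_add, Real.sin_add]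
    ring
  have hterm : ∀ i, Real.cos δ * b i ^ 2 - Real.sin δ * (|b i| * |c i|) ≤ b i * b' i := fun i => by
    have h1 : Real.cos δ ≤ Real.cos (ψ' i - ψ i) := by
      rw [← Real.cos_abs (ψ' i - ψ i)]
      exact Real.cos_le_cos_of_nonneg_of_le_pi (abs_nonneg _) (by linarith) (hψ i)
    have h2 : |Real.sin (ψ' i - ψ i)| ≤ Real.sin δ := by
      have h3 := abs_le.1 (hψ i)
      rw [abs_le, ← Real.sin_neg]
      exact ⟨Real.sin_le_sin_of_le_of_le_pi_div_two (by linarith) (by linarith) h3.1,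
        Real.sin_le_sin_of_le_of_le_pi_div_two (by linarith) (by linarith) h3.2⟩
    have h4 : -(Real.sin δ * (|b i| * |c i|)) ≤ b i * (Real.sin (ψ' i - ψ i) * c i) := by
      have h5 : |b i * (Real.sin (ψ' i - ψ i) * c i)| ≤ Real.sin δ * (|b i| * |c i|) := by
        rw [abs_mul, abs_mul, mul_left_comm]
        exact mul_le_mul_of_nonneg_right h2 (by positivity)
      exact (abs_le.1 h5).1
    rw [hcoord]
    nlinarith [mul_le_mul_of_nonneg_right h1 (sq_nonneg (b i))]
  have hCS : ∑ i, |b i| * |c i| ≤ ‖b‖ * ‖c‖ := by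
    have := Real.sum_mul_le_sqrt_mul_sqrt Finset.univ (fun i => |b i|) (fun i => |c i|)
    simpa [EuclideanSpace.norm_eq] using this
  have hCS' : ∑ i, b i * b' i ≤ ‖b‖ * ‖b'‖ := by
    have := real_inner_le_norm b' b
    simpa [PiLp.inner_apply, mul_comm] using this
  have hsum := Finset.sum_le_sum fun i (_ : i ∈ Finset.univ) => hterm i
  rw [Finset.sum_sub_distrib, ← Finset.mul_sum, ← Finset.mul_sum] at hsum
  have hb2 : ∑ i, b i ^ 2 = ‖b‖ ^ 2 := by simp [EuclideanSpace.norm_sq_eq]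
  rw [hb2] at hsum
  have h6 : ‖b‖ * Real.cos (α + δ) ≤ ‖b‖ * ‖b'‖ := by
    rw [Real.cos_add, hcos]
    have h7 := mul_le_mul_of_nonneg_left hCS hsd
    have h8 := mul_le_mul_of_nonneg_left (mul_le_mul_of_nonneg_left hcs h0.le) hsd
    nlinarith
  exact le_of_mul_le_mul_left h6 h0

variable [FiniteDimensional ℝ F] {n : ℕ}

/-- The angles whose cosines are the first `n` singular values of the analysis operator of a family
`x`. Here `n` is meant to be the dimension of the ambient space. -/
noncomputable def frameAngle (n : ℕ) (x : ι → F) (k : Fin n) : ℝ :=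
  Real.arccos ((analysisMap x).singularValues k)

theorem frameAngle_monotone (x : ι → F) : Monotone (frameAngle n x) := fun _ _ hij =>
  Real.arccos_le_arccos ((analysisMap x).singularValues_antitone hij)

theorem frameAngle_mem_Icc (x : ι → F) (k : Fin n) :
    frameAngle n x k ∈ Set.Icc 0 (Real.pi / 2) :=
  ⟨Real.arccos_nonneg _, Real.arccos_le_pi_div_two.2 (LinearMap.singularValues_nonneg _ _)⟩

theorem singularValues_analysisMap_le_one {x : ι → F}
    (hx : ∀ z, ∑ i, inner ℝ (x i) z ^ 2 ≤ ‖z‖ ^ 2) (hn : finrank ℝ F = n) (k : Fin n) :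
    (analysisMap x).singularValues k ≤ 1 := by
  obtain ⟨v, hv⟩ := exists_eigenbasis_frameOp hn x
  have h1 := hx (v k)
  rw [← inner_frameOp_self, hv, inner_smul_right, real_inner_self_eq_norm_sq] at h1
  simp at h1
  exact (le_abs_self _).trans h1

theorem cos_frameAngle {x : ι → F} (hx : ∀ z, ∑ i, inner ℝ (x i) z ^ 2 ≤ ‖z‖ ^ 2)
    (hn : finrank ℝ F = n) (k : Fin n) :
    Real.cos (frameAngle n x k) = (analysisMap x).singularValues k :=
  Real.cos_arccos (by linarith [(analysisMap x).singularValues_nonneg k])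
    (singularValues_analysisMap_le_one hx hn k)

/-- The `ℓ¹` estimate: the angles move in total by at most the total rotation of the frame. -/
theorem sum_abs_frameAngle_sub_le (hn : finrank ℝ F = n) {β γ : ι → F}
    (hβγ : ∀ z, ∑ i, inner ℝ (β i) z ^ 2 + ∑ i, inner ℝ (γ i) z ^ 2 ≤ ‖z‖ ^ 2) (ψ ψ' : ι → ℝ) :
    ∑ k, |frameAngle n (rotFrame β γ ψ') k - frameAngle n (rotFrame β γ ψ) k| ≤
      ∑ i, |ψ' i - ψ i| := by
  set C := ∑ i, |ψ' i - ψ i| with hC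
  refine sum_abs_sub_le_of_forall_lipschitz (frameAngle_monotone _) (frameAngle_monotone _)
    fun f hf => ?_
  have key : ∀ ε ∈ Set.Ioc (0 : ℝ) (1 / 4),
      ∑ j, f (frameAngle n (rotFrame β γ ψ') j) - ∑ j, f (frameAngle n (rotFrame β γ ψ) j) ≤
        C + ε * (C + 10 * n) := by
    rintro ε ⟨hε, hε'⟩
    obtain ⟨G, hG, hGf⟩ := exists_polynomial_near_of_lipschitz hf hε hε'
    have h1 := abs_sum_eval_sq_singularValues_sub_le hn hβγ (by positivity) hG ψ ψ'
    have h2 : ∀ ψ : ι → ℝ, |∑ k : Fin n,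
        G.eval ((analysisMap (rotFrame β γ ψ)).singularValues k ^ 2) -
        ∑ j, f (frameAngle n (rotFrame β γ ψ) j)| ≤ n * (5 * ε) := fun ψ => by
      rw [← Finset.sum_sub_distrib]
      refine (Finset.abs_sum_le_sum_abs _ _).trans ?_
      refine (Finset.sum_le_card_nsmul _ _ (5 * ε) fun j _ => ?_).trans_eq (by simp)
      rw [← cos_frameAngle (sum_inner_rotFrame_sq_le hβγ ψ) hn]
      exact hGf _ (frameAngle_mem_Icc _ _)
    have h3 := h2 ψ
    have h4 := h2 ψ'
    rw [abs_le] at h1 h3 h4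
    linarith [h1.2, h3.2, h4.1]
  refine le_of_forall_pos_le_add fun δ hδ => ?_
  have hC0 : 0 ≤ C := Finset.sum_nonneg fun _ _ => abs_nonneg _
  have hD : 0 < C + 10 * n + 1 := by positivity
  have hmin : 0 < min (1 / 4) (δ / (C + 10 * n + 1)) := lt_min (by norm_num) (by positivity)
  refine (key (min (1 / 4) (δ / (C + 10 * n + 1))) ⟨hmin, min_le_left _ _⟩).trans ?_
  have h5 : min (1 / 4) (δ / (C + 10 * n + 1)) * (C + 10 * n + 1) ≤ δ :=
    (mul_le_mul_of_nonneg_right (min_le_right _ _) hD.le).trans_eq (by field_simp)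
  nlinarith

theorem norm_sq_analysisMap_eq_sum_singularValues {x : ι → F} {v : OrthonormalBasis (Fin n) ℝ F}
    (hv : ∀ k, frameOp x (v k) = (analysisMap x).singularValues k ^ 2 • v k) (z : F) :
    ‖analysisMap x z‖ ^ 2 =
      ∑ k : Fin n, (analysisMap x).singularValues k ^ 2 * inner ℝ (v k) z ^ 2 := by
  have := inner_aeval_frameOp hv Polynomial.X z z
  rw [norm_sq_analysisMap, ← inner_frameOp_self, real_inner_comm]
  simpa [sq] using this

/-- On the span of the last `n - k` eigenvectors the norm is bounded by the `k`-th singular value,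
and on the span of the first `k + 1` eigenvectors it is bounded from below. Since these spans
for two families meet, some unit vector `z` compares the `k`-th singular values of both. -/
theorem exists_unit_vector_singularValues_le (hn : finrank ℝ F = n) (x x' : ι → F) (k : Fin n) :
    ∃ z : F, ‖z‖ = 1 ∧ (analysisMap x).singularValues k ≤ ‖analysisMap x z‖ ∧
      ‖analysisMap x' z‖ ≤ (analysisMap x').singularValues k := by
  obtain ⟨v, hv⟩ := exists_eigenbasis_frameOp hn x
  obtain ⟨v', hv'⟩ := exists_eigenbasis_frameOp hn x'
  -- the conditions `z ⊥ v_j` for `j > k` and `z ⊥ v'_j` for `j < k` are `n - 1` in number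
  set Λ : F →ₗ[ℝ] ({j : Fin n // j ≠ k} → ℝ) :=
    LinearMap.pi fun j => (innerSL ℝ (if k < j.1 then v j.1 else v' j.1)).toLinearMap with hΛ
  have hker : LinearMap.ker Λ ≠ ⊥ := by
    apply LinearMap.ker_ne_bot_of_finrank_lt
    rw [hn]
    simp
    exact k.pos
  obtain ⟨z₀, hz₀, hz0⟩ := (Submodule.ne_bot_iff _).1 hker
  have hΛ0 : ∀ j, j ≠ k → inner ℝ (if k < j then v j else v' j) z₀ = 0 := fun j hj => by
    simpa [hΛ] using congrFun (LinearMap.mem_ker.1 hz₀) ⟨j, hj⟩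
  have hnz : ‖z₀‖ ≠ 0 := norm_ne_zero_iff.2 hz0
  set z := ‖z₀‖⁻¹ • z₀ with hz
  have hz1 : ‖z‖ = 1 := by simp [hz, norm_smul, hnz]
  have hvz : ∀ j, k < j → inner ℝ (v j) z = 0 := fun j hj => by
    have := hΛ0 j hj.ne'
    rw [if_pos hj] at this
    simp [hz, inner_smul_right, this]
  have hvz' : ∀ j, j < k → inner ℝ (v' j) z = 0 := fun j hj => by
    have := hΛ0 j hj.ne
    rw [if_neg hj.not_gt] at this
    simp [hz, inner_smul_right, this]
  have hs : ∀ w : OrthonormalBasis (Fin n) ℝ F, ∑ j, inner ℝ (w j) z ^ 2 = 1 := fun w => by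
    have := w.sum_sq_norm_inner_right z
    simpa [hz1] using this
  have hanti : ∀ y : ι → F, ∀ i j : Fin n, i ≤ j →
      (analysisMap y).singularValues j ^ 2 ≤ (analysisMap y).singularValues i ^ 2 :=
    fun y i j hij => pow_le_pow_left₀ (LinearMap.singularValues_nonneg _ _)
      ((analysisMap y).singularValues_antitone hij) 2
  refine ⟨z, hz1, ?_, ?_⟩
  · refine le_of_sq_le_sq ?_ (norm_nonneg _)
    rw [norm_sq_analysisMap_eq_sum_singularValues hv,
      ← mul_one ((analysisMap x).singularValues k ^ 2), ← hs v,
      Finset.mul_sum]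
    refine Finset.sum_le_sum fun j _ => ?_
    rcases lt_or_ge k j with hj | hj
    · simp [hvz j hj]
    · exact mul_le_mul_of_nonneg_right (hanti x j k hj) (sq_nonneg _)
  · refine le_of_sq_le_sq ?_ (LinearMap.singularValues_nonneg _ _)
    rw [norm_sq_analysisMap_eq_sum_singularValues hv',
      ← mul_one ((analysisMap x').singularValues k ^ 2),
      ← hs v', Finset.mul_sum]
    refine Finset.sum_le_sum fun j _ => ?_
    rcases lt_or_ge j k with hj | hj
    · simp [hvz' j hj]
    · exact mul_le_mul_of_nonneg_right (hanti x' k j hj) (sq_nonneg _)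

/-- The `ℓ^∞` estimate: no angle moves by more than the largest rotation of the frame. -/
theorem abs_frameAngle_sub_le (hn : finrank ℝ F = n) {β γ : ι → F}
    (hβγ : ∀ z, ∑ i, inner ℝ (β i) z ^ 2 + ∑ i, inner ℝ (γ i) z ^ 2 ≤ ‖z‖ ^ 2) {ψ ψ' : ι → ℝ}
    {δ : ℝ} (hδ : δ ∈ Set.Icc 0 (Real.pi / 2)) (hψ : ∀ i, |ψ' i - ψ i| ≤ δ) (k : Fin n) :
    |frameAngle n (rotFrame β γ ψ') k - frameAngle n (rotFrame β γ ψ) k| ≤ δ := by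
  have key : ∀ ψ ψ' : ι → ℝ, (∀ i, |ψ' i - ψ i| ≤ δ) →
      frameAngle n (rotFrame β γ ψ') k ≤ frameAngle n (rotFrame β γ ψ) k + δ := by
    intro ψ ψ' h
    obtain ⟨z, hz, h1, h2⟩ :=
      exists_unit_vector_singularValues_le hn (rotFrame β γ ψ) (rotFrame β γ ψ') k
    have h3 := arccos_norm_analysisMap_le hβγ hδ h hz
    have h4 := Real.arccos_le_arccos h1
    have h5 := Real.arccos_le_arccos h2
    unfold frameAngle
    linarith
  rw [abs_le]
  have h1 := key ψ ψ' hψ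
  have h2 := key ψ' ψ fun i => by rw [abs_sub_comm]; exact hψ i
  constructor <;> linarith

end Angles

/-! ### The convex hull of a Weyl group orbit -/

/-- Abel summation: nonnegative tail sums pair nonnegatively with a monotone sequence. -/
theorem mul_sum_le_sum_mul_of_tail_sum_nonneg {n : ℕ} {a D : Fin n → ℝ} (ha : Monotone a)
    (hD : ∀ k, 0 ≤ ∑ i, if k ≤ i then D i else 0) {c : ℝ} (hc : ∀ i, c ≤ a i) :
    c * ∑ i, D i ≤ ∑ i, a i * D i := by
  induction n generalizing c with
  | zero => simp
  | succ n ih =>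
    have h1 := ih (a := fun i => a i.succ) (D := fun i => D i.succ)
      (fun i j hij => ha (Fin.succ_le_succ_iff.2 hij))
      (fun k => by simpa [Fin.sum_univ_succ, Fin.succ_le_succ_iff] using hD k.succ)
      (c := a 0) (fun i => ha (Fin.zero_le _))
    have h2 := hD 0
    simp only [Fin.zero_le, if_true] at h2
    have h3 := mul_le_mul_of_nonneg_right (hc 0) h2
    rw [Fin.sum_univ_succ] at h3 ⊢
    rw [Fin.sum_univ_succ (f := fun i => a i * D i)]
    linarith

theorem sum_mul_le_sum_mul_of_tail_sum_le {n : ℕ} {a ζ ψ : Fin n → ℝ} (ha : Monotone a)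
    (ha0 : ∀ i, 0 ≤ a i)
    (h : ∀ k, ∑ i, (if k ≤ i then ζ i else 0) ≤ ∑ i, if k ≤ i then ψ i else 0) :
    ∑ i, a i * ζ i ≤ ∑ i, a i * ψ i := by
  have := mul_sum_le_sum_mul_of_tail_sum_nonneg ha (D := fun i => ψ i - ζ i) (fun k => by
    have := h k
    rw [← sub_nonneg, ← Finset.sum_sub_distrib] at this
    refine this.trans_eq (Finset.sum_congr rfl fun i _ => ?_)
    split_ifs <;> simp) ha0
  simp only [mul_sub, Finset.sum_sub_distrib, zero_mul] at this
  linarith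

theorem coordSign_coordPerm_mem_orbit {p : ℕ} (ψ : Fin p → ℝ) (ε : Fin p → ℤˣ)
    (σ : Equiv.Perm (Fin p)) :
    coordSign ε (coordPerm σ ψ) ∈ MulAction.orbit (weylGroup p) ψ :=
  ⟨⟨coordSign ε * coordPerm σ, mul_mem
    (Subgroup.subset_closure (Or.inr ⟨ε, rfl⟩)) (Subgroup.subset_closure (Or.inl ⟨σ, rfl⟩))⟩, rfl⟩

/-- A vector lies in the convex hull of the orbit of `ψ` as soon as, for each threshold
`α = ψ_k`, it splits into a part with entries at most `α` and a part with `ℓ¹` norm at most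
`∑ (ψ_i - α)⁺`. With `α` the `m`-th largest entry of `ψ` this bounds the sum of any `m` entries
of `|z|` by the sum of the `m` largest entries of `ψ`. -/
theorem mem_weylHull_of_forall_split {p : ℕ} {ψ z : Fin p → ℝ} (hψm : Monotone ψ)
    (h : ∀ k, ∃ w : Fin p → ℝ, (∀ i, |z i - w i| ≤ ψ k) ∧ ∑ i, |w i| ≤ ∑ i, max (ψ i - ψ k) 0) :
    z ∈ weylHull ψ := by
  set X : Set (Fin p → ℝ) :=
    Set.range fun s : (Fin p → ℤˣ) × Equiv.Perm (Fin p) => coordSign s.1 (coordPerm s.2 ψ) with hX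
  have hXsub : convexHull ℝ X ⊆ weylHull ψ := convexHull_mono <| by
    rintro _ ⟨s, rfl⟩
    exact coordSign_coordPerm_mem_orbit ψ s.1 s.2
  refine hXsub ?_
  by_contra hz
  obtain ⟨f, u, hfu, huz⟩ := geometric_hahn_banach_closed_point (convex_convexHull ℝ X)
    ((Set.finite_range _).isClosed_convexHull ℝ) hz
  set y : Fin p → ℝ := fun i => f (Pi.single i 1) with hy
  have hf : ∀ v, f v = ∑ i, v i * y i := fun v => by
    have := LinearMap.pi_apply_eq_sum_univ f.toLinearMap v
    simp only [ContinuousLinearMap.coe_coe, smul_eq_mul] at this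
    rw [this]
    refine Finset.sum_congr rfl fun i _ => ?_
    congr 2
    ext j
    simp [Pi.single_apply, eq_comm]
  -- the extreme point of the hull in the direction `y`
  set τ := Tuple.sort fun i => |y i| with hτ
  have hmono : Monotone fun i => |y (τ i)| := Tuple.monotone_sort fun i => |y i|
  set ε : Fin p → ℤˣ := fun i => if 0 ≤ y i then 1 else -1 with hε
  have h1 : f (coordSign ε (coordPerm τ.symm ψ)) = ∑ i, |y (τ i)| * ψ i := by
    rw [hf, ← Equiv.sum_comp τ]
    refine Finset.sum_congr rfl fun i _ => ?_
    rw [coordSign_apply, coordPerm_apply, Equiv.symm_apply_apply]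
    by_cases hi : 0 ≤ y (τ i)
    · simp [hε, hi, abs_of_nonneg hi, mul_comm]
    · simp [hε, hi, abs_of_neg (not_le.1 hi), mul_comm]
  have h2 : f z ≤ ∑ i, |y (τ i)| * |z (τ i)| := by
    rw [hf, Equiv.sum_comp τ fun i => |y i| * |z i|]
    refine Finset.sum_le_sum fun i _ => ?_
    rw [← abs_mul, mul_comm]
    exact le_abs_self _
  have h3 : ∑ i, |y (τ i)| * |z (τ i)| ≤ ∑ i, |y (τ i)| * ψ i := by
    refine sum_mul_le_sum_mul_of_tail_sum_le hmono (fun _ => abs_nonneg _) fun k => ?_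
    -- the threshold `ψ k` is the smallest of the entries in the tail
    obtain ⟨w, hw1, hw2⟩ := h k
    calc ∑ i, (if k ≤ i then |z (τ i)| else 0)
        ≤ ∑ i, ((if k ≤ i then ψ k else 0) + |w (τ i)|) := by
          refine Finset.sum_le_sum fun i _ => ?_
          split_ifs
          · have := abs_add_le (z (τ i) - w (τ i)) (w (τ i))
            rw [sub_add_cancel] at this
            linarith [hw1 (τ i)]
          · simp
      _ = ∑ i, (if k ≤ i then ψ k else 0) + ∑ i, |w i| := by
          rw [Finset.sum_add_distrib, Equiv.sum_comp τ fun i => |w i|]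
      _ ≤ ∑ i, (if k ≤ i then ψ k else 0) + ∑ i, max (ψ i - ψ k) 0 := by gcongr
      _ = ∑ i, if k ≤ i then ψ i else 0 := by
          rw [← Finset.sum_add_distrib]
          refine Finset.sum_congr rfl fun i _ => ?_
          split_ifs with hki
          · rw [max_eq_left (sub_nonneg.2 (hψm hki))]; ring
          · rw [max_eq_right (sub_nonpos.2 (hψm (not_le.1 hki).le))]; simp
  have h4 := hfu _ (subset_convexHull ℝ X ⟨(ε, τ.symm), rfl⟩)
  simp only [h1] at h4
  linarith

/-! ### Jordan angles and principal vectors -/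

theorem singularValues_adjoint {E : Type*} [NormedAddCommGroup E] [InnerProductSpace ℝ E]
    [FiniteDimensional ℝ E] (T : E →ₗ[ℝ] E) :
    (LinearMap.adjoint T).singularValues = T.singularValues := by
  ext i
  by_cases hi : i < finrank ℝ E
  · rw [LinearMap.singularValues_of_lt _ rfl hi, LinearMap.singularValues_of_lt _ rfl hi]
    have := (LinearMap.IsSymmetric.eigenvalues_eq_eigenvalues_iff
      (LinearMap.adjoint T).isSymmetric_adjoint_comp_self rfl
      T.isSymmetric_adjoint_comp_self rfl).2 (by
        let b := (stdOrthonormalBasis ℝ E).toBasis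
        rw [LinearMap.adjoint_adjoint, ← LinearMap.charpoly_toMatrix _ b,
          ← LinearMap.charpoly_toMatrix (LinearMap.adjoint T ∘ₗ T) b,
          LinearMap.toMatrix_comp b b b, LinearMap.toMatrix_comp b b b, Matrix.charpoly_mul_comm])
    rw [this]
  · rw [LinearMap.singularValues_of_finrank_le _ (by omega),
      LinearMap.singularValues_of_finrank_le _ (by omega)]

namespace RealGr

variable {p q : ℕ}

theorem cosAngle_comm (L M : RealGr p q) (j : Fin p) : cosAngle L M j = cosAngle M L j := by
  have : gramMatrix M.basis L.basis = (gramMatrix L.basis M.basis).conjTranspose := by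
    ext i j
    simp [gramMatrix, real_inner_comm]
  rw [cosAngle, cosAngle, this, Matrix.toEuclideanLin_conjTranspose_eq_adjoint,
    singularValues_adjoint]

/-- The cosines of the Jordan angles between `L` and `N` are the singular values of the analysis
operator on `L` of the projected orthonormal basis of `N`. -/
theorem cosAngle_eq_singularValues_analysisMap (L N : RealGr p q)
    (f : OrthonormalBasis (Fin p) ℝ N.1) (j : Fin p) :
    cosAngle L N j = (analysisMap fun i =>
      L.1.orthogonalProjectionOnto (f i : EuclideanSpace ℝ (Fin (p + q)))).singularValues j := by
  have : (analysisMap fun i =>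
      L.1.orthogonalProjectionOnto (f i : EuclideanSpace ℝ (Fin (p + q)))) =
      f.repr.toLinearEquiv.toLinearMap ∘ₗ
        ((N.1.orthogonalProjectionOnto : _ →ₗ[ℝ] N.1) ∘ₗ L.1.subtype) ∘ₗ
        (LinearIsometryEquiv.refl ℝ L.1).toLinearEquiv.toLinearMap := by
    ext z i
    simp [f.repr_apply_apply]
  rw [cosAngle_comm, cosAngle, toEuclideanLin_gramMatrix, this, singularValues_isometry_comp,
    singularValues_isometry_comp]

end RealGr

/-- Bessel's inequality for pairwise orthogonal vectors of norm at most one. -/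
theorem sum_inner_sq_le_of_pairwise_orthogonal {κ E : Type*} [Fintype κ] [NormedAddCommGroup E]
    [InnerProductSpace ℝ E] {u : κ → E} (hu : ∀ i j, i ≠ j → inner ℝ (u i) (u j) = 0)
    (hu1 : ∀ i, ‖u i‖ ≤ 1) (z : E) : ∑ i, inner ℝ (u i) z ^ 2 ≤ ‖z‖ ^ 2 := by
  set y := ∑ i, inner ℝ (u i) z • u i with hy
  have h1 : inner ℝ y z = ∑ i, inner ℝ (u i) z ^ 2 := by
    simp [hy, sum_inner, inner_smul_left, sq]
  have h2 : ‖y‖ ^ 2 ≤ ∑ i, inner ℝ (u i) z ^ 2 := by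
    rw [← real_inner_self_eq_norm_sq]
    nth_rewrite 1 [hy]
    rw [sum_inner]
    refine Finset.sum_le_sum fun i _ => ?_
    have h3 : inner ℝ (u i) y = inner ℝ (u i) z * ‖u i‖ ^ 2 := by
      rw [hy, inner_sum, Finset.sum_eq_single i]
      · rw [inner_smul_right, real_inner_self_eq_norm_sq]
      · intro j _ hj
        rw [inner_smul_right, hu i j hj.symm, mul_zero]
      · simp
    rw [inner_smul_left, h3]
    have h4 : ‖u i‖ ^ 2 ≤ 1 := pow_le_one₀ (norm_nonneg _) (hu1 i)
    simp only [conj_trivial]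
    nlinarith [sq_nonneg (inner ℝ (u i) z)]
  have h5 := norm_sub_sq_real y z
  rw [h1] at h5
  nlinarith [sq_nonneg ‖y - z‖]

/-- Principal vectors: `V` is obtained from `U` by rotating an orthonormal basis `e_i` of `U`
through angles `φ_i` towards orthogonal directions `g_i`. The cosines of the angles are the singular values
of the orthogonal projection `V → U`, written as an analysis operator with the help of some
orthonormal basis `b` of `U`. If `φ_i = 0` then `g_i = 0`. -/
theorem exists_principal_vectors {p : ℕ} {E : Type*} [NormedAddCommGroup E]
    [InnerProductSpace ℝ E] [FiniteDimensional ℝ E] (U V : Submodule ℝ E)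
    (hV : finrank ℝ V = p) (b : OrthonormalBasis (Fin p) ℝ U) :
    ∃ (e : OrthonormalBasis (Fin p) ℝ U) (f : OrthonormalBasis (Fin p) ℝ V) (g : Fin p → E),
      (∀ i, (f i : E) =
        Real.cos (frameAngle p (fun i => V.orthogonalProjectionOnto (b i : E)) i) • (e i : E) +
          Real.sin (frameAngle p (fun i => V.orthogonalProjectionOnto (b i : E)) i) • g i) ∧
      ∀ z, ∑ i, inner ℝ (e i : E) z ^ 2 + ∑ i, inner ℝ (g i) z ^ 2 ≤ ‖z‖ ^ 2 := by
  set x : Fin p → V := fun i => V.orthogonalProjectionOnto (b i : E) with hx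
  obtain ⟨f, hf⟩ := exists_eigenbasis_frameOp hV x
  set c : Fin p → ℝ := fun k => (analysisMap x).singularValues k with hc
  have hc0 : ∀ i, 0 ≤ c i := fun i => LinearMap.singularValues_nonneg _ _
  have hf' : ∀ i, frameOp x (f i) = c i ^ 2 • f i := hf
  set P : Fin p → U := fun i =>
    U.orthogonalProjectionOnto (f i : E) with hP
  have hfo : ∀ i j, inner ℝ (f i) (f j) = if i = j then (1 : ℝ) else 0 :=
    orthonormal_iff_ite.1 f.orthonormal
  have hPP : ∀ i j, inner ℝ (P i) (P j) = if i = j then c i ^ 2 else 0 := fun i j => by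
    have h1 : inner ℝ (P i) (P j) = inner ℝ (f i) (frameOp x (f j)) := by
      rw [← b.sum_inner_mul_inner, frameOp_apply, inner_sum]
      refine Finset.sum_congr rfl fun k _ => ?_
      have h2 : ∀ k i, inner ℝ (b k) (P i) = inner ℝ (x k) (f i) := fun k i => by
        rw [real_inner_comm, hP, hx, Submodule.inner_orthogonalProjectionOnto_eq_of_mem_right,
          Submodule.inner_orthogonalProjectionOnto_eq_of_mem_right, real_inner_comm]
      rw [real_inner_comm, h2, h2, inner_smul_right, real_inner_comm (x k) (f i)]
      ring
    rw [h1, hf', inner_smul_right, hfo]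
    split_ifs with hij <;> simp [hij]
  -- orthonormal vectors in the directions of the nonzero projections
  obtain ⟨e, he⟩ := Orthonormal.exists_orthonormalBasis_extension_of_card_eq (𝕜 := ℝ)
    (ι := Fin p) (by simp [finrank_eq_card_basis b.toBasis])
    (v := fun i => (c i)⁻¹ • P i) (s := {i | c i ≠ 0}) (by
      rw [orthonormal_iff_ite]
      rintro ⟨i, hi⟩ ⟨j, hj⟩
      simp only [Set.domRestrict_apply, inner_smul_left, inner_smul_right, conj_trivial, hPP,
        Subtype.mk.injEq]
      split_ifs with hij
      · subst hij
        have : c i ≠ 0 := hi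
        field_simp
      · simp)
  have hPe : ∀ i, P i = c i • e i := fun i => by
    by_cases hi : c i = 0
    · have h1 := hPP i i
      rw [hi] at h1 ⊢
      simpa using h1
    · rw [he i hi, smul_smul, mul_inv_cancel₀ hi, one_smul]
  have hc1 : ∀ i, c i ≤ 1 := fun i => by
    have h1 := U.norm_orthogonalProjectionOnto_apply_le
      (f i : E)
    have h2 : ‖P i‖ ^ 2 = c i ^ 2 := by rw [← real_inner_self_eq_norm_sq, hPP, if_pos rfl]
    have h3 : ‖(f i : E)‖ = 1 := f.orthonormal.1 i
    have h4 : ‖P i‖ ≤ 1 := h1.trans_eq h3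
    rw [pow_left_inj₀ (norm_nonneg _) (hc0 i) two_ne_zero] at h2
    rwa [← h2]
  have hcos : ∀ i, Real.cos (frameAngle p x i) = c i := fun i =>
    Real.cos_arccos (by linarith [hc0 i]) (hc1 i)
  set s : Fin p → ℝ := fun i => Real.sin (frameAngle p x i) with hs
  have hs2 : ∀ i, s i ^ 2 = 1 - c i ^ 2 := fun i => by
    rw [hs, Real.sin_sq, hcos]
  -- the components of the `f i` orthogonal to `M`
  set h : Fin p → E := fun i => (f i : E) - P i with hh
  have hhM : ∀ i (m : U), inner ℝ (h i) (m : E) = 0 := fun i m => by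
    rw [hh, inner_sub_left, sub_eq_zero, ← Submodule.inner_orthogonalProjectionOnto_eq_of_mem_right,
      Submodule.coe_inner]
  have hhh : ∀ i j, inner ℝ (h i) (h j) = if i = j then s i ^ 2 else 0 := fun i j => by
    have h0 : inner ℝ (f j : E) (P i : E) = inner ℝ (P j) (P i) := by
      have := hhM j (P i)
      rwa [inner_sub_left, sub_eq_zero] at this
    have h1 : inner ℝ (h i) (h j) = inner ℝ (f i) (f j) - inner ℝ (P i) (P j) := by
      calc inner ℝ (h i) (h j) = inner ℝ (h i) (f j : E) - inner ℝ (h i) (P j : E) :=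
            inner_sub_right _ _ _
        _ = inner ℝ (f i : E) (f j : E) - inner ℝ (P i : E) (f j : E) := by
            rw [hhM, sub_zero, ← inner_sub_left]
        _ = _ := by rw [real_inner_comm (f j : E) (P i : E), h0, real_inner_comm (P i) (P j)]; rfl
    rw [h1, hfo, hPP]
    split_ifs with hij
    · rw [hs2]
    · simp
  refine ⟨e, f, fun i => (s i)⁻¹ • h i, fun i => ?_, fun z => ?_⟩
  · have h1 : (s i) • (s i)⁻¹ • h i = h i := by
      by_cases hi : s i = 0
      · have h2 := hhh i i
        rw [if_pos rfl, hi] at h2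
        have h3 : h i = 0 := by simpa using h2
        simp [h3]
      · rw [smul_smul, mul_inv_cancel₀ hi, one_smul]
    rw [hcos, h1]
    simp [hh, hPe]
  · have := sum_inner_sq_le_of_pairwise_orthogonal
      (u := Sum.elim (fun i => (e i : E)) fun i => (s i)⁻¹ • h i)
      (by
        rintro (i | i) (j | j) hij
        · have : i ≠ j := fun h => hij (h ▸ rfl)
          simpa using e.orthonormal.2 this
        · simp [inner_smul_right, real_inner_comm (h j), hhM]
        · simp [inner_smul_left, hhM]
        · have : i ≠ j := fun h => hij (h ▸ rfl)
          simp [inner_smul_left, inner_smul_right, hhh, this])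
      (by
        rintro (i | i)
        · exact (e.orthonormal.1 i).le
        · have h1 : ‖h i‖ ^ 2 = s i ^ 2 := by
            rw [← real_inner_self_eq_norm_sq, hhh, if_pos rfl]
          have h2 : ‖h i‖ = |s i| := by rw [← abs_norm]; exact (sq_eq_sq_iff_abs_eq_abs _ _).1 h1
          simp only [Sum.elim_inr, norm_smul, norm_inv, Real.norm_eq_abs, h2]
          exact inv_mul_le_one) z
    simpa using this

/-! ### The triangle inequality for Jordan angles -/

theorem theoremB (p q : ℕ) (hp : 0 < p) (hpq : p ≤ q) (L M N : RealGr p q)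
    (φ ψ θ : Fin p → ℝ) (hφ : φ = RealGr.jordanAngle L M) (hψ : ψ = RealGr.jordanAngle M N)
    (hθ : θ = RealGr.jordanAngle L N) :
    ∃ θ' ∈ (fun z => φ + z) '' weylHull ψ,
      ∃ σ : Equiv.Perm (Fin p), ∀ j, Real.cos (θ' (σ j)) = Real.cos (θ j) := by
  refine ⟨θ, ⟨θ - φ, ?_, add_sub_cancel φ θ⟩, Equiv.refl _, fun j => rfl⟩
  obtain ⟨e, f, g, hf, hg⟩ := exists_principal_vectors M.1 N.1 N.2 M.basis
  have hψ' : ψ = frameAngle p fun i =>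
      N.1.orthogonalProjectionOnto (M.basis i : EuclideanSpace ℝ (Fin (p + q))) := by
    ext j
    rw [hψ, RealGr.jordanAngle, RealGr.cosAngle_comm,
      RealGr.cosAngle_eq_singularValues_analysisMap N M M.basis, frameAngle]
  rw [← hψ'] at hf
  clear hψ'
  set pr := L.1.orthogonalProjectionOnto with hpr
  set β : Fin p → L.1 := fun i => pr (e i : EuclideanSpace ℝ (Fin (p + q))) with hβ
  set γ : Fin p → L.1 := fun i => pr (g i) with hγ
  have hβγ : ∀ z, ∑ i, inner ℝ (β i) z ^ 2 + ∑ i, inner ℝ (γ i) z ^ 2 ≤ ‖z‖ ^ 2 := fun z => by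
    simpa [hβ, hγ, hpr] using hg (z : EuclideanSpace ℝ (Fin (p + q)))
  have hθ' : θ = frameAngle p (rotFrame β γ ψ) := by
    ext j
    rw [hθ, RealGr.jordanAngle, RealGr.cosAngle_eq_singularValues_analysisMap L N f, frameAngle]
    congr 4
    ext1 i
    simp [rotFrame, hf, hβ, hγ, hpr]
  have hφ' : φ = frameAngle p (rotFrame β γ 0) := by
    ext j
    rw [hφ, RealGr.jordanAngle, RealGr.cosAngle_eq_singularValues_analysisMap L M e, frameAngle]
    congr 4
    ext1 i
    simp [rotFrame, hβ, hpr]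
  have hψI : ∀ i, ψ i ∈ Set.Icc 0 (Real.pi / 2) := fun i => by
    rw [hψ]
    exact ⟨Real.arccos_nonneg _,
      Real.arccos_le_pi_div_two.2 (LinearMap.singularValues_nonneg _ _)⟩
  have hψm : Monotone ψ := by
    rw [hψ]
    exact fun i j hij => Real.arccos_le_arccos (LinearMap.singularValues_antitone _ hij)
  refine mem_weylHull_of_forall_split hψm fun k => ?_
  -- stop the rotation from `M` to `N` when the angles reach the threshold `ψ k`
  set ψ' : Fin p → ℝ := fun i => min (ψ i) (ψ k) with hψ'
  refine ⟨fun j => frameAngle p (rotFrame β γ ψ) j - frameAngle p (rotFrame β γ ψ') j,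
    fun j => ?_, ?_⟩
  · have := abs_frameAngle_sub_le L.2 hβγ (hψI k) (ψ := 0) (ψ' := ψ') (fun i => by
      simp only [hψ', Pi.zero_apply, sub_zero]
      rw [abs_of_nonneg (le_min (hψI i).1 (hψI k).1)]
      exact min_le_right _ _) j
    rw [hθ', hφ', Pi.sub_apply]
    convert this using 2
    ring
  · refine (sum_abs_frameAngle_sub_le L.2 hβγ ψ' ψ).trans_eq
      (Finset.sum_congr rfl fun i _ => ?_)
    rw [abs_of_nonneg (sub_nonneg.2 (min_le_left _ _))]
    simp only [hψ']
    rcases le_total (ψ i) (ψ k) with h | h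
    · rw [min_eq_left h, max_eq_right (sub_nonpos.2 h), sub_self]
    · rw [min_eq_right h, max_eq_left (sub_nonneg.2 h)]
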